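/- Let $d\ge 1$, $\gamma,c_1,C_1,\beta,L>0$, and write $\varphi_t(x)=(2\pi t)^{-d/2}e^{-\|x\|^2/(2t)}$ for $x\in\mathbb R^d$, $t>0$. Let $p_0$ be a probability density on $\mathbb R^d$ such that $p_0(x)\le C_1\exp(-c_1\|x\|^\gamma)$ (almost everywhere) and such that, with $\mathcal F[p_0](\omega)=\int p_0(x)e^{-i\langle\omega,x\rangle}\,dx$, $$\int_{\mathbb R^d}|\omega^\alpha|^2\,|\mathcal F[p_0](\omega)|^2\,d\omega\le(2\pi)^dL^2\qquad\text{for all }\alpha\in\mathbb N_0^d\text{ with }\textstyle\sum_i\alpha_i=\beta .$$ Put $p_t=\varphi_t*p_0$ and $s_t=\nabla\log p_t$. From i.i.d. samples $X^{(1)},\dots,X^{(n)}\sim p_0$, $n\ge 2$, form $$\hat p_t(x)=\frac1n\sum_{i=1}^n\varphi_t(x-X^{(i)}),\qquad \nabla\hat p_t(x)=\frac1{nt}\sum_{i=1}^n(X^{(i)}-x)\,\varphi_t(x-X^{(i)}),$$ $$\hat s_t(x)=\frac{\nabla\hat p_t(x)}{\hat p_t(x)}\mathbf 1_{\{\hat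 p_t(x)\ge\rho_n\}},\qquad \rho_n=\frac{\log n}{n(2\pi t)^{d/2}} .$$ Then there is an exponent $k\in\mathbb N$ depending only on $(d,\gamma,c_1,C_1,\beta,L)$ such that the following holds. For every $T>0$ there is a constant $C_T>0$, depending only on $(d,\gamma,c_1,C_1,\beta,L)$ and $T$, such that for all such $p_0$, all $n\ge2$ and all $0<t_0<T$, $$\int_{t_0}^T\mathbb E\Big[\int_{\mathbb R^d}\|\hat s_t(x)-s_t(x)\|^2p_t(x)\,dx\Big]dt\le C_T\,(\log n)^k\,n^{-1}\,t_0^{-d/2}.$$ Moreover, if $t_0\le 1$, then the dependence on $T$ is at most logarithmic: there is $C>0$ depending only on $(d,\gamma,c_1,C_1,\beta,L)$ such that for all such $p_0$, all $n\ge 2$ and all $0<t_0<T$ with $t_0\le 1$ the left side is at most $C\,(1+\max(0,\log T))\,(\log n)^k\,n^{-1}\,t_0^{-d/2}$; in particular the bound $\lesssim\operatorname{polylog}(n)\,n^{-1}t_0^{-d/2}$ also holds when $T$ grows polynomially in $n$. -/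

import Mathlib

open MeasureTheory
open scoped ENNReal

namespace HeavyTailScore

noncomputable section

/-- The space `ℝ^d` with the Euclidean norm. -/
abbrev Space (d : ℕ) : Type := EuclideanSpace ℝ (Fin d)

/-- The Gaussian transition density
`φ_t(x) = (2πt)^{-d/2} exp(-‖x‖² / (2t))` on `ℝ^d` (for `t > 0`). -/
def gaussianKernel {d : ℕ} (t : ℝ) (x : Space d) : ℝ :=
  ((2 * Real.pi * t) ^ ((d : ℝ) / 2))⁻¹ * Real.exp (-‖x‖ ^ 2 / (2 * t))

/-- The Fourier transform `𝓕[f](ω) = ∫ f(x) exp(-i⟨ω, x⟩) dx`. -/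
def fourierTransform {d : ℕ} (f : Space d → ℝ) (ω : Space d) : ℂ :=
  ∫ x : Space d, (f x : ℂ) * Complex.exp (-(Complex.I * ((inner ℝ ω x : ℝ) : ℂ)))

/-- `p` is a probability density on `ℝ^d` with respect to Lebesgue measure. -/
structure IsProbDensity {d : ℕ} (p : Space d → ℝ) : Prop where
  integrable : Integrable p
  nonneg : ∀ᵐ x, 0 ≤ p x
  integral_eq_one : ∫ x, p x = 1

/-- The Sobolev class of probability densities with smoothness `β` and radius `L`:
`∫ |ω^α|² |𝓕[p](ω)|² dω ≤ (2π)^d L²` for every multi-index `α` of order `β`.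
The integral is taken in `[0, ∞]`, so that the bound contains its finiteness. -/
structure SobolevClass {d : ℕ} (β L : ℝ) (p : Space d → ℝ) : Prop where
  density : IsProbDensity p
  bound : ∀ α : Fin d → ℕ, ((∑ i, α i : ℕ) : ℝ) = β →
    ∫⁻ ω : Space d,
        ENNReal.ofReal (|∏ i, ω i ^ α i| ^ 2 * ‖fourierTransform p ω‖ ^ 2)
      ≤ ENNReal.ofReal ((2 * Real.pi) ^ d * L ^ 2)

/-- (Stretched) exponential tail decay: `p(x) ≤ C₁ exp(-c₁ ‖x‖^γ)` for almost every `x`. -/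
def ExpTail {d : ℕ} (γ c₁ C₁ : ℝ) (p : Space d → ℝ) : Prop :=
  ∀ᵐ x, p x ≤ C₁ * Real.exp (-c₁ * ‖x‖ ^ γ)

/-- The law on `ℝ^d` with density `p`. -/
def lawOf {d : ℕ} (p : Space d → ℝ) : Measure (Space d) :=
  volume.withDensity fun x => ENNReal.ofReal (p x)

/-- The marginal density `p_t = φ_t * p₀` of `X₀ + √t Z`, where `X₀ ∼ p₀` and `Z ∼ N(0, I_d)`
are independent. -/
def marginalDensity {d : ℕ} (p₀ : Space d → ℝ) (t : ℝ) (x : Space d) : ℝ :=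
  ∫ y : Space d, gaussianKernel t (x - y) * p₀ y

/-- The score `s_t = ∇ log p_t`. -/
def score {d : ℕ} (p₀ : Space d → ℝ) (t : ℝ) (x : Space d) : Space d :=
  gradient (fun z => Real.log (marginalDensity p₀ t z)) x

/-- The Gaussian kernel density estimator
`p̂_t(x) = (1/n) ∑ φ_t(x - X⁽ⁱ⁾)` built from the sample `X`. -/
def kde {d n : ℕ} (X : Fin n → Space d) (t : ℝ) (x : Space d) : ℝ :=
  (n : ℝ)⁻¹ * ∑ i, gaussianKernel t (x - X i)

/-- The gradient of the kernel density estimator,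
`∇p̂_t(x) = (1/(nt)) ∑ (X⁽ⁱ⁾ - x) φ_t(x - X⁽ⁱ⁾)`. -/
def kdeGradient {d n : ℕ} (X : Fin n → Space d) (t : ℝ) (x : Space d) : Space d :=
  ((n : ℝ) * t)⁻¹ • ∑ i, gaussianKernel t (x - X i) • (X i - x)

/-- The truncation level `ρ_n = log n / (n (2πt)^{d/2})`. -/
def threshold (d n : ℕ) (t : ℝ) : ℝ :=
  Real.log n / ((n : ℝ) * (2 * Real.pi * t) ^ ((d : ℝ) / 2))

open Classical in
/-- The thresholded score estimator
`ŝ_t(x) = (∇p̂_t(x) / p̂_t(x)) 1{p̂_t(x) ≥ ρ_n}`. -/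
def scoreEstimator {d n : ℕ} (X : Fin n → Space d) (t : ℝ) (x : Space d) : Space d :=
  if threshold d n t ≤ kde X t x then (kde X t x)⁻¹ • kdeGradient X t x else 0

/-- The mean integrated squared error `E[∫ ‖ŝ_t(x) - s_t(x)‖² p_t(x) dx]`, where the expectation
is over `n` i.i.d. samples from `p₀`, that is, over the `n`-fold product of the law of `p₀`.
It is an element of `[0, ∞]`. -/
def scoreError {d : ℕ} (p₀ : Space d → ℝ) (n : ℕ) (t : ℝ) : ℝ≥0∞ :=
  ∫⁻ X : Fin n → Space d,
    (∫⁻ x : Space d,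
      ENNReal.ofReal (‖scoreEstimator X t x - score p₀ t x‖ ^ 2 * marginalDensity p₀ t x))
    ∂(Measure.pi fun _ : Fin n => lawOf p₀)

/-- The score error accumulated over the diffusion times `[t₀, T]`, an element of `[0, ∞]`. -/
def integratedScoreError {d : ℕ} (p₀ : Space d → ℝ) (n : ℕ) (t₀ T : ℝ) : ℝ≥0∞ :=
  ∫⁻ t in Set.Icc t₀ T, scoreError p₀ n t

end

end HeavyTailScore

namespace HeavyTailScore

/-! Write `M = (2πt)^{-d/2}` for the peak of the kernel and `p = p_t`. The heart of the matter is a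
bound at a single point `x`: the expectation of `‖ŝ_t(x) - s_t(x)‖² p(x)` is at most a constant
times `M (log n)² / (n t)`, whatever the value of `p(x)` (`lintegral_error_le`).

The kernel weighted by `‖x - y‖²/t²` is `2M/t` times the entropy function `-u log u` at `u = φ_t(x -
y)/M`. Cauchy–Schwarz and Jensen therefore give `‖s_t‖² ≤ (2/t) log(M/p)` for any smoothed
probability measure. The kernel density estimator is a smoothed empirical measure, so above the
threshold both the true and the estimated score are `O((log n / t)^{1/2})`, for every sample. Where
`p ≥ 2ρ_n`, linearising the quotient costs a factor `1/p`, which cancels against the variances `M p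
/ n` and `2 M p / (n t)` of the estimator and its gradient. Where `p < 2ρ_n`, the weight `p` is
itself of order `M log n / n`.

This bound is integrated over a ball of radius `(a + 2√t)(2 log n)^m`, whose volume contributes at
most a constant times `(1 + t^{d/2})` and powers of `log n`; the factor `t^{d/2}` cancels the peak.
Outside the ball a crude bound by `p_{2t}` and the tails of `p₀` and of the Gaussian give another
`polylog(n)/(n t)`. So the error at time `t` is `polylog(n) n⁻¹ t⁻¹ (1 + t^{-d/2})`
(`exists_scoreError_le`), and integration in `t` yields `log(T/t₀)` and `t₀^{-d/2}`. -/

/-! ### The Gaussian kernel -/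

/-- The maximal value `(2πt)^{-d/2}` of the Gaussian kernel. -/
noncomputable def gaussianPeak (d : ℕ) (t : ℝ) : ℝ := ((2 * Real.pi * t) ^ ((d : ℝ) / 2))⁻¹

lemma gaussianPeak_pos (d : ℕ) {t : ℝ} (ht : 0 < t) : 0 < gaussianPeak d t := by
  unfold gaussianPeak; have := Real.pi_pos; positivity

lemma gaussianKernel_eq {d : ℕ} (t : ℝ) (x : Space d) :
    gaussianKernel t x = gaussianPeak d t * Real.exp (-(‖x‖ ^ 2 / (2 * t))) := by
  rw [gaussianKernel, gaussianPeak, neg_div]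

lemma gaussianKernel_pos {d : ℕ} {t : ℝ} (ht : 0 < t) (x : Space d) : 0 < gaussianKernel t x := by
  rw [gaussianKernel_eq]; exact mul_pos (gaussianPeak_pos d ht) (Real.exp_pos _)

lemma gaussianKernel_le_peak {d : ℕ} {t : ℝ} (ht : 0 < t) (x : Space d) :
    gaussianKernel t x ≤ gaussianPeak d t := by
  rw [gaussianKernel_eq]
  refine mul_le_of_le_one_right (gaussianPeak_pos d ht).le (Real.exp_le_one_iff.2 ?_)
  have : 0 ≤ ‖x‖ ^ 2 / (2 * t) := by positivity
  linarith

@[fun_prop]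
lemma continuous_gaussianKernel {d : ℕ} (t : ℝ) :
    Continuous (gaussianKernel t : Space d → ℝ) := by
  unfold gaussianKernel; fun_prop

lemma gaussianPeak_eq_two_mul (d : ℕ) {t : ℝ} (ht : 0 < t) :
    gaussianPeak d t = 2 ^ ((d : ℝ) / 2) * gaussianPeak d (2 * t) := by
  have := Real.pi_pos
  have h : (2 * Real.pi * (2 * t)) ^ ((d : ℝ) / 2)
      = 2 ^ ((d : ℝ) / 2) * (2 * Real.pi * t) ^ ((d : ℝ) / 2) := by
    rw [← Real.mul_rpow (by norm_num) (by positivity)]; congr 1; ring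
  have h2 : (2 : ℝ) ^ ((d : ℝ) / 2) ≠ 0 := by positivity
  rw [gaussianPeak, gaussianPeak, h, mul_inv, mul_inv_cancel_left₀ h2]

/-- Half of the exponent is kept in a kernel of doubled variance. The remaining Gaussian factor can
then absorb a polynomial weight or serve as a tail bound. -/
lemma gaussianKernel_eq_two_mul {d : ℕ} {t : ℝ} (ht : 0 < t) (x : Space d) :
    gaussianKernel t x
      = 2 ^ ((d : ℝ) / 2) * gaussianKernel (2 * t) x * Real.exp (-(‖x‖ ^ 2 / (4 * t))) := by
  rw [gaussianKernel_eq, gaussianKernel_eq, gaussianPeak_eq_two_mul d ht, mul_assoc, mul_assoc,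
    mul_assoc, ← Real.exp_add]
  congr 4; field_simp; ring

lemma gaussianKernel_le_two_mul {d : ℕ} {t : ℝ} (ht : 0 < t) (x : Space d) :
    gaussianKernel t x ≤ 2 ^ ((d : ℝ) / 2) * gaussianKernel (2 * t) x := by
  rw [gaussianKernel_eq_two_mul ht]
  have := gaussianKernel_pos (by positivity : 0 < 2 * t) x
  refine mul_le_of_le_one_right (by positivity) (Real.exp_le_one_iff.2 ?_)
  have : 0 ≤ ‖x‖ ^ 2 / (4 * t) := by positivity
  linarith

lemma mul_exp_neg_le_one (a : ℝ) : a * Real.exp (-a) ≤ 1 := by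
  rw [Real.exp_neg, ← div_eq_mul_inv, div_le_one (Real.exp_pos a)]
  linarith [Real.add_one_le_exp a]

lemma gaussianKernel_mul_sq_le_two_mul {d : ℕ} {t : ℝ} (ht : 0 < t) (x : Space d) :
    gaussianKernel t x * (‖x‖ ^ 2 / t ^ 2)
      ≤ 4 / t * (2 ^ ((d : ℝ) / 2) * gaussianKernel (2 * t) x) := by
  have hk := gaussianKernel_pos (by positivity : 0 < 2 * t) x
  have h := mul_exp_neg_le_one (‖x‖ ^ 2 / (4 * t))
  rw [gaussianKernel_eq_two_mul ht]
  calc _ = 4 / t * (2 ^ ((d : ℝ) / 2) * gaussianKernel (2 * t) x) *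
        (‖x‖ ^ 2 / (4 * t) * Real.exp (-(‖x‖ ^ 2 / (4 * t)))) := by field_simp
    _ ≤ _ := mul_le_of_le_one_right (by positivity) h

/-- The second moment weight of the kernel is the entropy of the normalised kernel. -/
lemma gaussianKernel_mul_sq_eq {d : ℕ} {t : ℝ} (ht : 0 < t) (x : Space d) :
    gaussianKernel t x * (‖x‖ ^ 2 / t ^ 2)
      = 2 * gaussianPeak d t / t * Real.negMulLog (gaussianKernel t x / gaussianPeak d t) := by
  have hM := gaussianPeak_pos d ht
  rw [gaussianKernel_eq, mul_div_cancel_left₀ _ hM.ne', Real.negMulLog, Real.log_exp]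
  field_simp

lemma gaussianKernel_mul_sq_le {d : ℕ} {t : ℝ} (ht : 0 < t) (x : Space d) :
    gaussianKernel t x * (‖x‖ ^ 2 / t ^ 2) ≤ 2 * gaussianPeak d t / t := by
  have hM := gaussianPeak_pos d ht
  have h := mul_exp_neg_le_one (‖x‖ ^ 2 / (2 * t))
  rw [gaussianKernel_eq]
  calc _ = 2 * gaussianPeak d t / t *
        (‖x‖ ^ 2 / (2 * t) * Real.exp (-(‖x‖ ^ 2 / (2 * t)))) := by field_simp
    _ ≤ _ := mul_le_of_le_one_right (by positivity) h

lemma integral_gaussianKernel {d : ℕ} {t : ℝ} (ht : 0 < t) :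
    ∫ x : Space d, gaussianKernel t x = 1 := by
  have h := GaussianFourier.integral_rexp_neg_mul_sq_norm (V := Space d)
    (b := (2 * t)⁻¹) (by positivity)
  have hM : (2 * Real.pi * t) ^ ((d : ℝ) / 2) ≠ 0 := by have := Real.pi_pos; positivity
  simp only [gaussianKernel_eq, gaussianPeak]
  rw [integral_const_mul, inv_mul_eq_one₀ hM]
  calc _ = (Real.pi / (2 * t)⁻¹) ^ ((Module.finrank ℝ (Space d) : ℝ) / 2) := by
        rw [finrank_euclideanSpace_fin]; congr 1; field_simp
    _ = _ := by rw [← h]; congr 1; ext x; congr 1; field_simp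

lemma integrable_gaussianKernel {d : ℕ} {t : ℝ} (ht : 0 < t) :
    Integrable (gaussianKernel t : Space d → ℝ) :=
  Integrable.of_integral_ne_zero (by rw [integral_gaussianKernel ht]; exact one_ne_zero)

lemma lintegral_gaussianKernel {d : ℕ} {t : ℝ} (ht : 0 < t) :
    ∫⁻ x : Space d, ENNReal.ofReal (gaussianKernel t x) = 1 := by
  rw [← ofReal_integral_eq_lintegral_ofReal (integrable_gaussianKernel ht)
    (.of_forall fun x => (gaussianKernel_pos ht x).le), integral_gaussianKernel ht,
    ENNReal.ofReal_one]

/-! ### Gaussian smoothing of a probability measure -/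

/-- The density of `μ * N(0, t I)`. -/
noncomputable def smoothed {d : ℕ} (μ : Measure (Space d)) (t : ℝ) (x : Space d) : ℝ :=
  ∫ y, gaussianKernel t (x - y) ∂μ

/-- The gradient of the density of `μ * N(0, t I)`. -/
noncomputable def smoothedGradient {d : ℕ} (μ : Measure (Space d)) (t : ℝ) (x : Space d) :
    Space d :=
  ∫ y, gaussianKernel t (x - y) • (t⁻¹ • (y - x)) ∂μ

/-- The density times the conditional second moment of the score of the Gaussian kernel. -/
noncomputable def smoothedEnergy {d : ℕ} (μ : Measure (Space d)) (t : ℝ) (x : Space d) : ℝ :=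
  ∫ y, gaussianKernel t (x - y) * (‖x - y‖ ^ 2 / t ^ 2) ∂μ

section Smoothing

variable {d : ℕ} (μ : Measure (Space d)) [IsProbabilityMeasure μ] {t : ℝ} (ht : 0 < t)
  (x : Space d)

include ht

lemma integrable_gaussianKernel_sub : Integrable (fun y => gaussianKernel t (x - y)) μ := by
  refine Integrable.of_bound (by fun_prop) (gaussianPeak d t) (.of_forall fun y => ?_)
  rw [Real.norm_of_nonneg (gaussianKernel_pos ht _).le]
  exact gaussianKernel_le_peak ht _

lemma integrable_gaussianKernel_mul_sq :
    Integrable (fun y => gaussianKernel t (x - y) * (‖x - y‖ ^ 2 / t ^ 2)) μ := by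
  refine Integrable.of_bound (by fun_prop) (2 * gaussianPeak d t / t) (.of_forall fun y => ?_)
  have := gaussianKernel_pos ht (x - y)
  rw [Real.norm_of_nonneg (by positivity)]
  exact gaussianKernel_mul_sq_le ht _

lemma norm_gaussianKernel_smul (y : Space d) :
    ‖gaussianKernel t (x - y) • (t⁻¹ • (y - x))‖ = gaussianKernel t (x - y) * (‖x - y‖ / t) := by
  rw [norm_smul, norm_smul, norm_inv, Real.norm_of_nonneg ht.le,
    Real.norm_of_nonneg (gaussianKernel_pos ht _).le, norm_sub_rev]
  ring

lemma gaussianKernel_mul_norm_le (y : Space d) :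
    gaussianKernel t (x - y) * (‖x - y‖ / t) ≤ gaussianPeak d t + 2 * gaussianPeak d t / t := by
  have h1 := gaussianKernel_mul_sq_le ht (x - y)
  have h2 := gaussianKernel_le_peak ht (x - y)
  have h3 := gaussianKernel_pos ht (x - y)
  have h4 : ‖x - y‖ / t ≤ 1 + ‖x - y‖ ^ 2 / t ^ 2 := by
    rw [← div_pow]; nlinarith [sq_nonneg (‖x - y‖ / t - 1), sq_nonneg (‖x - y‖ / t)]
  nlinarith [mul_le_mul_of_nonneg_left h4 h3.le]

lemma integrable_gaussianKernel_smul :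
    Integrable (fun y => gaussianKernel t (x - y) • (t⁻¹ • (y - x))) μ := by
  refine Integrable.of_bound (by fun_prop) (gaussianPeak d t + 2 * gaussianPeak d t / t)
    (.of_forall fun y => ?_)
  rw [norm_gaussianKernel_smul ht]
  exact gaussianKernel_mul_norm_le ht x y

lemma smoothed_pos : 0 < smoothed μ t x := by
  rw [smoothed, integral_pos_iff_support_of_nonneg (fun y => (gaussianKernel_pos ht _).le)
    (integrable_gaussianKernel_sub μ ht x)]
  have : Function.support (fun y => gaussianKernel t (x - y)) = Set.univ :=
    Set.eq_univ_of_forall fun y => (gaussianKernel_pos ht _).ne'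
  rw [this]; simp

/-- Cauchy–Schwarz for the gradient of a smoothed measure. -/
lemma sq_norm_smoothedGradient_le :
    ‖smoothedGradient μ t x‖ ^ 2 ≤ smoothed μ t x * smoothedEnergy μ t x := by
  have hp := smoothed_pos μ ht x
  have h0 := integrable_gaussianKernel_sub μ ht x
  have h2 := integrable_gaussianKernel_mul_sq μ ht x
  have h1 : Integrable (fun y => gaussianKernel t (x - y) * (‖x - y‖ / t)) μ := by
    simpa only [norm_gaussianKernel_smul ht] using (integrable_gaussianKernel_smul μ ht x).norm
  set I := ∫ y, gaussianKernel t (x - y) * (‖x - y‖ / t) ∂μ with hI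
  have hG : ‖smoothedGradient μ t x‖ ≤ I := by
    rw [hI, smoothedGradient]; simpa only [norm_gaussianKernel_smul ht] using
      norm_integral_le_integral_norm (μ := μ) fun y => gaussianKernel t (x - y) • (t⁻¹ • (y - x))
  -- The integral of the kernel times `(‖x - y‖/t - c)²`; the choice of `c` below minimises this
  -- quadratic.
  have key : ∀ c : ℝ, 0 ≤ smoothedEnergy μ t x - 2 * c * I + c ^ 2 * smoothed μ t x := by
    intro c
    rw [smoothedEnergy, hI, smoothed, ← integral_const_mul, ← integral_const_mul,
      ← integral_sub h2 (h1.const_mul _)]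
    refine le_of_le_of_eq ?_ (integral_add (h2.sub (h1.const_mul _)) (h0.const_mul _))
    refine integral_nonneg fun y => ?_
    have := gaussianKernel_pos ht (x - y)
    calc (0 : ℝ) ≤ gaussianKernel t (x - y) * (‖x - y‖ / t - c) ^ 2 := by positivity
      _ = _ := by ring
  have := key (I / smoothed μ t x)
  have h3 : I ^ 2 ≤ smoothed μ t x * smoothedEnergy μ t x := by
    have h4 : 0 ≤ smoothed μ t x * (smoothedEnergy μ t x - 2 * (I / smoothed μ t x) * I
        + (I / smoothed μ t x) ^ 2 * smoothed μ t x) := by positivity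
    have h5 : smoothed μ t x * (smoothedEnergy μ t x - 2 * (I / smoothed μ t x) * I
        + (I / smoothed μ t x) ^ 2 * smoothed μ t x)
        = smoothed μ t x * smoothedEnergy μ t x - I ^ 2 := by field_simp; ring
    linarith
  exact (pow_le_pow_left₀ (norm_nonneg _) hG 2).trans h3

/-- Jensen's inequality for the entropy of the normalised kernel. -/
lemma smoothedEnergy_le_log :
    smoothedEnergy μ t x
      ≤ 2 / t * (smoothed μ t x * Real.log (gaussianPeak d t / smoothed μ t x)) := by
  have hM := gaussianPeak_pos d ht
  have hp := smoothed_pos μ ht x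
  -- By `gaussianKernel_mul_sq_eq` the left side of Jensen's inequality is the energy up to the
  -- factor `2M/t`.
  have hJ := Real.concaveOn_negMulLog.le_map_integral (μ := μ)
    (f := fun y => gaussianKernel t (x - y) / gaussianPeak d t)
    Real.continuous_negMulLog.continuousOn isClosed_Ici
    (.of_forall fun y => (div_pos (gaussianKernel_pos ht _) hM).le)
    ((integrable_gaussianKernel_sub μ ht x).div_const _) (by
      have := (integrable_gaussianKernel_mul_sq μ ht x).const_mul (t / (2 * gaussianPeak d t))
      refine this.congr (.of_forall fun y => ?_)
      simp only [gaussianKernel_mul_sq_eq ht, Function.comp]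
      field_simp)
  rw [integral_div] at hJ
  change _ ≤ Real.negMulLog (smoothed μ t x / gaussianPeak d t) at hJ
  simp only [smoothedEnergy, gaussianKernel_mul_sq_eq ht]
  rw [integral_const_mul]
  refine (mul_le_mul_of_nonneg_left hJ (by positivity)).trans_eq ?_
  rw [Real.negMulLog, ← inv_div (smoothed μ t x) (gaussianPeak d t), Real.log_inv]
  field_simp

lemma sq_norm_smoothedGradient_le_log :
    ‖smoothedGradient μ t x‖ ^ 2
      ≤ smoothed μ t x ^ 2 * (2 / t * Real.log (gaussianPeak d t / smoothed μ t x)) := by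
  refine (sq_norm_smoothedGradient_le μ ht x).trans
    ((mul_le_mul_of_nonneg_left (smoothedEnergy_le_log μ ht x) (smoothed_pos μ ht x).le).trans_eq ?_)
  ring

/-- Unlike the logarithmic bound, this one is integrable in `x` with explicit tails. -/
lemma smoothedEnergy_le_two_mul :
    smoothedEnergy μ t x ≤ 4 / t * (2 ^ ((d : ℝ) / 2) * smoothed μ (2 * t) x) := by
  have h0 := integrable_gaussianKernel_sub μ (by positivity : 0 < 2 * t) x
  rw [smoothedEnergy, smoothed, ← integral_const_mul, ← integral_const_mul]
  exact integral_mono (integrable_gaussianKernel_mul_sq μ ht x)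
    ((h0.const_mul _).const_mul _) fun y => gaussianKernel_mul_sq_le_two_mul ht _

lemma smoothed_le_two_mul : smoothed μ t x ≤ 2 ^ ((d : ℝ) / 2) * smoothed μ (2 * t) x := by
  rw [smoothed, smoothed, ← integral_const_mul]
  exact integral_mono (integrable_gaussianKernel_sub μ ht x)
    ((integrable_gaussianKernel_sub μ (by positivity : 0 < 2 * t) x).const_mul _)
    fun y => gaussianKernel_le_two_mul ht _

lemma hasGradientAt_gaussianKernel (y : Space d) :
    HasGradientAt (fun z => gaussianKernel t (z - y))
      (gaussianKernel t (x - y) • (t⁻¹ • (y - x))) x := by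
  have h1 : HasFDerivAt (fun z : Space d => ‖z - y‖ ^ 2) (2 • innerSL ℝ (x - y)) x := by
    simpa [Function.comp_def] using
      (hasStrictFDerivAt_norm_sq (x - y)).hasFDerivAt.comp x ((hasFDerivAt_id x).sub_const y)
  have h2 := ((h1.const_mul (-(2 * t)⁻¹)).exp).const_mul (gaussianPeak d t)
  have h3 : (fun z => gaussianKernel t (z - y))
      = fun z => gaussianPeak d t * Real.exp (-(2 * t)⁻¹ * ‖z - y‖ ^ 2) := by
    ext z; rw [gaussianKernel_eq]; congr 2; field_simp
  rw [hasGradientAt_iff_hasFDerivAt, h3]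
  refine h2.congr_fderiv ?_
  have h4 : gaussianKernel t (x - y)
      = gaussianPeak d t * Real.exp (-(2 * t)⁻¹ * ‖x - y‖ ^ 2) := congrFun h3 x
  ext v
  rw [InnerProductSpace.toDual_apply_apply, inner_smul_left, inner_smul_left, ← neg_sub x y,
    inner_neg_left, h4]
  simp [inner_sub_left]
  field_simp
  ring

lemma hasGradientAt_smoothed :
    HasGradientAt (smoothed μ t) (smoothedGradient μ t x) x := by
  rw [hasGradientAt_iff_hasFDerivAt]
  have h := hasFDerivAt_integral_of_dominated_of_fderiv_le (𝕜 := ℝ) (μ := μ) (s := Set.univ)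
    (x₀ := x) (F := fun z y => gaussianKernel t (z - y))
    (F' := fun z y => InnerProductSpace.toDual ℝ (Space d)
      (gaussianKernel t (z - y) • (t⁻¹ • (y - z))))
    (bound := fun _ => gaussianPeak d t + 2 * gaussianPeak d t / t)
    -- The gradient of the kernel is bounded on the whole space, so a constant dominates it for all
    -- `z`.
    Filter.univ_mem (.of_forall fun z => by fun_prop) (integrable_gaussianKernel_sub μ ht x)
    (by fun_prop)
    (.of_forall fun y z _ => by
      rw [LinearIsometryEquiv.norm_map, norm_gaussianKernel_smul ht]
      exact gaussianKernel_mul_norm_le ht z y)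
    (integrable_const _)
    (.of_forall fun y z _ => (hasGradientAt_gaussianKernel ht z y).hasFDerivAt)
  refine h.congr_fderiv ?_
  exact ((InnerProductSpace.toDual ℝ (Space d)).toContinuousLinearEquiv.toContinuousLinearMap
    |>.integral_comp_comm (integrable_gaussianKernel_smul μ ht x))

lemma gradient_log_smoothed :
    gradient (fun z => Real.log (smoothed μ t z)) x
      = (smoothed μ t x)⁻¹ • smoothedGradient μ t x := by
  apply HasGradientAt.gradient
  rw [hasGradientAt_iff_hasFDerivAt]
  have := (hasGradientAt_smoothed μ ht x).hasFDerivAt.log (smoothed_pos μ ht x).ne'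
  simpa using this

end Smoothing

/-! ### The kernel density estimator as a smoothed empirical measure -/

/-- The empirical measure of a sample. -/
noncomputable def empirical {d n : ℕ} (X : Fin n → Space d) : Measure (Space d) :=
  (n : ℝ≥0∞)⁻¹ • ∑ i, Measure.dirac (X i)

lemma isProbabilityMeasure_empirical {d n : ℕ} (hn : 2 ≤ n) (X : Fin n → Space d) :
    IsProbabilityMeasure (empirical X) := by
  refine ⟨?_⟩
  have h : (n : ℝ≥0∞) ≠ 0 := by exact_mod_cast (by omega : n ≠ 0)
  simp [empirical, ENNReal.inv_mul_cancel h (ENNReal.natCast_ne_top n)]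

lemma integral_empirical {d n : ℕ} {E : Type*} [NormedAddCommGroup E] [NormedSpace ℝ E]
    [CompleteSpace E] (X : Fin n → Space d) (f : Space d → E) :
    ∫ y, f y ∂(empirical X) = (n : ℝ)⁻¹ • ∑ i, f (X i) := by
  rw [empirical, integral_smul_measure, integral_finsetSum_measure]
  · simp [integral_dirac]
  · exact fun i _ => integrable_dirac (by simp [enorm_lt_top])

lemma smoothed_empirical {d n : ℕ} (X : Fin n → Space d) (t : ℝ) (x : Space d) :
    smoothed (empirical X) t x = kde X t x := by
  rw [smoothed, integral_empirical X, kde, smul_eq_mul]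

lemma smoothedGradient_empirical {d n : ℕ} (X : Fin n → Space d) (t : ℝ) (x : Space d) :
    smoothedGradient (empirical X) t x = kdeGradient X t x := by
  rw [smoothedGradient, integral_empirical X, kdeGradient, mul_inv, mul_smul,
    Finset.smul_sum (r := t⁻¹)]
  simp only [smul_comm t⁻¹]

lemma threshold_eq (d n : ℕ) (t : ℝ) :
    threshold d n t = gaussianPeak d t * Real.log n / n := by
  rw [threshold, gaussianPeak]; field_simp

lemma half_le_log {n : ℕ} (hn : 2 ≤ n) : 1 / 2 ≤ Real.log n := by
  have h : Real.log 2 ≤ Real.log n := Real.log_le_log (by norm_num) (by exact_mod_cast hn)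
  linarith [Real.log_two_gt_d9]

lemma threshold_pos (d : ℕ) {n : ℕ} (hn : 2 ≤ n) {t : ℝ} (ht : 0 < t) : 0 < threshold d n t := by
  have := half_le_log hn
  have := gaussianPeak_pos d ht
  rw [threshold_eq]; positivity

/-- Above the threshold the score of a smoothed measure is of order `(log n / t)^{1/2}`. -/
lemma sq_norm_score_le_of_threshold_le {d n : ℕ} (hn : 2 ≤ n) (μ : Measure (Space d))
    [IsProbabilityMeasure μ] {t : ℝ} (ht : 0 < t) (x : Space d)
    (h : threshold d n t ≤ smoothed μ t x) :
    ‖(smoothed μ t x)⁻¹ • smoothedGradient μ t x‖ ^ 2 ≤ 4 * Real.log n / t := by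
  have hp := smoothed_pos μ ht x
  have hM := gaussianPeak_pos d ht
  have hl := half_le_log hn
  have hn2 : (2 : ℝ) ≤ n := by exact_mod_cast hn
  -- From `p ≥ M log n / n`, `log n ≥ 1/2` and `n ≥ 2` one gets `M ≤ 2 n p ≤ n² p`.
  have hlog : Real.log (gaussianPeak d t / smoothed μ t x) ≤ 2 * Real.log n := by
    rw [← Nat.cast_two, ← Real.log_pow]
    refine Real.log_le_log (by positivity) ((div_le_iff₀ hp).2 ?_)
    rw [threshold_eq, div_le_iff₀ (by positivity)] at h
    nlinarith [mul_le_mul_of_nonneg_left hl hM.le, mul_le_mul_of_nonneg_left hn2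
      (mul_nonneg hp.le (by positivity : (0 : ℝ) ≤ n))]
  rw [norm_smul, mul_pow, norm_inv, Real.norm_of_nonneg hp.le, inv_pow,
    inv_mul_le_iff₀ (by positivity)]
  refine (sq_norm_smoothedGradient_le_log μ ht x).trans
    (mul_le_mul_of_nonneg_left ?_ (by positivity))
  calc _ ≤ 2 / t * (2 * Real.log n) := mul_le_mul_of_nonneg_left hlog (by positivity)
    _ = _ := by ring

/-- The estimator is the score of the smoothed empirical measure, cut off at the threshold, so the
bound holds for every sample and not just on average. -/
lemma sq_norm_scoreEstimator_le {d n : ℕ} (hn : 2 ≤ n) (X : Fin n → Space d) {t : ℝ} (ht : 0 < t)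
    (x : Space d) : ‖scoreEstimator X t x‖ ^ 2 ≤ 4 * Real.log n / t := by
  have := half_le_log hn
  have := isProbabilityMeasure_empirical hn X
  rw [scoreEstimator]
  split_ifs with h
  · rw [← smoothed_empirical, ← smoothedGradient_empirical]
    rw [← smoothed_empirical] at h
    exact sq_norm_score_le_of_threshold_le hn _ ht x h
  · rw [norm_zero, zero_pow two_ne_zero]; positivity

/-! ### Pointwise error bounds for a fixed sample -/

lemma sq_norm_sub_le {E : Type*} [SeminormedAddCommGroup E] (a b : E) :
    ‖a - b‖ ^ 2 ≤ 2 * (‖a‖ ^ 2 + ‖b‖ ^ 2) :=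
  (pow_le_pow_left₀ (norm_nonneg _) (norm_sub_le a b) 2).trans (add_sq_le)

lemma sq_norm_score_mul_le {d : ℕ} (μ : Measure (Space d)) [IsProbabilityMeasure μ] {t : ℝ}
    (ht : 0 < t) (x : Space d) :
    ‖(smoothed μ t x)⁻¹ • smoothedGradient μ t x‖ ^ 2 * smoothed μ t x ≤ smoothedEnergy μ t x := by
  have hp := smoothed_pos μ ht x
  have h := sq_norm_smoothedGradient_le μ ht x
  rw [norm_smul, mul_pow, norm_inv, Real.norm_of_nonneg hp.le]
  calc _ = ‖smoothedGradient μ t x‖ ^ 2 / smoothed μ t x := by field_simp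
    _ ≤ _ := by rwa [div_le_iff₀' hp]

/-- If `q ≥ p/2`, then `e - s = q⁻¹((g - G) - (q - p)s)` with `s = G/p`, and `p/q ≤ 2`. Otherwise
`|q - p| ≥ p/2`, and the a priori bound `B` on `e` and `s` suffices; no formula for `e` is needed
there. -/
lemma quotient_error_le {E : Type*} [NormedAddCommGroup E] [NormedSpace ℝ E] {g G e : E}
    {p q B : ℝ} (hp : 0 < p) (he : ‖e‖ ^ 2 ≤ B) (hs : ‖p⁻¹ • G‖ ^ 2 ≤ B)
    (h : p / 2 ≤ q → e = q⁻¹ • g) :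
    ‖e - p⁻¹ • G‖ ^ 2 * p ≤ 16 / p * (‖g - G‖ ^ 2 + B * (q - p) ^ 2) := by
  set s := p⁻¹ • G with hs'
  have hB : 0 ≤ B := (sq_nonneg _).trans hs
  have hG : G = p • s := by rw [hs', smul_inv_smul₀ hp.ne']
  suffices H : ‖e - s‖ ^ 2 * p ^ 2 ≤ 16 * (‖g - G‖ ^ 2 + B * (q - p) ^ 2) by
    calc _ = (‖e - s‖ ^ 2 * p ^ 2) / p := by field_simp
      _ ≤ 16 * (‖g - G‖ ^ 2 + B * (q - p) ^ 2) / p := by gcongr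
      _ = _ := by ring
  rcases le_or_gt (p / 2) q with hq | hq
  · have hq0 : 0 < q := by linarith
    have hdec : e - s = q⁻¹ • ((g - G) - (q - p) • s) := by
      rw [h hq, hG, sub_smul, smul_sub, smul_sub, smul_sub, inv_smul_smul₀ hq0.ne']; abel
    have h1 := sq_norm_sub_le (g - G) ((q - p) • s)
    rw [norm_smul, mul_pow, Real.norm_eq_abs, sq_abs] at h1
    have h2 : (q - p) ^ 2 * ‖s‖ ^ 2 ≤ (q - p) ^ 2 * B := by gcongr
    have h3 : p ^ 2 / q ^ 2 ≤ 4 := by rw [div_le_iff₀ (by positivity)]; nlinarith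
    rw [hdec, norm_smul, mul_pow, norm_inv, Real.norm_of_nonneg hq0.le]
    calc _ = p ^ 2 / q ^ 2 * ‖g - G - (q - p) • s‖ ^ 2 := by field_simp
      _ ≤ 4 * (2 * (‖g - G‖ ^ 2 + (q - p) ^ 2 * B)) := by gcongr; linarith
      _ ≤ _ := by nlinarith [sq_nonneg ‖g - G‖, mul_nonneg hB (sq_nonneg (q - p))]
  · have h1 := sq_norm_sub_le e s
    have h2 : p ^ 2 ≤ 4 * (q - p) ^ 2 := by nlinarith
    calc _ ≤ (2 * (B + B)) * (4 * (q - p) ^ 2) := by gcongr; linarith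
      _ ≤ _ := by nlinarith [sq_nonneg ‖g - G‖, mul_nonneg hB (sq_nonneg (q - p))]

section Deterministic

variable {d n : ℕ} (hn : 2 ≤ n) (μ : Measure (Space d)) [IsProbabilityMeasure μ] {t : ℝ}
  (ht : 0 < t) (X : Fin n → Space d) (x : Space d)

include hn ht

/-- The weight `p` cancels the denominator of the true score, so no lower bound on the density is
required. -/
lemma error_le_energy :
    ‖scoreEstimator X t x - (smoothed μ t x)⁻¹ • smoothedGradient μ t x‖ ^ 2 * smoothed μ t x
      ≤ 2 * (4 * Real.log n / t * smoothed μ t x + smoothedEnergy μ t x) := by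
  have hp := smoothed_pos μ ht x
  have h1 := mul_le_mul_of_nonneg_right (sq_norm_scoreEstimator_le hn X ht x) hp.le
  have h2 := sq_norm_score_mul_le μ ht x
  have h3 := mul_le_mul_of_nonneg_right (sq_norm_sub_le (scoreEstimator X t x)
    ((smoothed μ t x)⁻¹ • smoothedGradient μ t x)) hp.le
  linarith

/-- A crude bound on the error, used far away from the origin. -/
lemma error_le_smoothed_two_mul :
    ‖scoreEstimator X t x - (smoothed μ t x)⁻¹ • smoothedGradient μ t x‖ ^ 2 * smoothed μ t x
      ≤ 24 * Real.log n / t * (2 ^ ((d : ℝ) / 2) * smoothed μ (2 * t) x) := by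
  have hl := half_le_log hn
  have h2 := smoothed_pos μ (by positivity : 0 < 2 * t) x
  refine (error_le_energy hn μ ht X x).trans ?_
  have h3 := mul_le_mul_of_nonneg_left (smoothed_le_two_mul μ ht x)
    (by positivity : 0 ≤ 4 * Real.log n / t)
  have h4 := smoothedEnergy_le_two_mul μ ht x
  have h5 : 0 ≤ (2 * Real.log n - 1) * (8 / t * (2 ^ ((d : ℝ) / 2) * smoothed μ (2 * t) x)) :=
    mul_nonneg (by linarith) (by positivity)
  calc _ ≤ 2 * (4 * Real.log n / t * (2 ^ ((d : ℝ) / 2) * smoothed μ (2 * t) x)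
        + 4 / t * (2 ^ ((d : ℝ) / 2) * smoothed μ (2 * t) x)) := by linarith
    _ = 24 * Real.log n / t * (2 ^ ((d : ℝ) / 2) * smoothed μ (2 * t) x)
        - (2 * Real.log n - 1) * (8 / t * (2 ^ ((d : ℝ) / 2) * smoothed μ (2 * t) x)) := by ring
    _ ≤ _ := by linarith

/-- The error where the density is below twice the threshold. -/
lemma error_le_of_lt_threshold (h : smoothed μ t x < 2 * threshold d n t) :
    ‖scoreEstimator X t x - (smoothed μ t x)⁻¹ • smoothedGradient μ t x‖ ^ 2 * smoothed μ t x
      ≤ 256 * gaussianPeak d t * Real.log n ^ 2 / (n * t) := by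
  have hl := half_le_log hn
  have hM := gaussianPeak_pos d ht
  have hp := smoothed_pos μ ht x
  have hn2 : (2 : ℝ) ≤ n := by exact_mod_cast hn
  set l := Real.log n with hl'
  set M := gaussianPeak d t
  set p := smoothed μ t x
  rw [threshold_eq] at h
  -- Since `p` may be arbitrarily small, `log (M/p)` is unbounded. Splitting off `log n` and using
  -- `log u ≤ u - 1` leaves a term that becomes `M/n` after multiplication by `p`.
  have hlog : Real.log (M / p) ≤ l + (M / (n * p) - 1) := by
    have : Real.log (M / p) = l + Real.log (M / (n * p)) := by
      rw [hl', ← Real.log_mul (by positivity) (by positivity)]; congr 1; field_simp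
    rw [this]; gcongr; exact Real.log_le_sub_one_of_pos (by positivity)
  have hE : smoothedEnergy μ t x ≤ 2 / t * (p * l + M / n) := by
    refine (smoothedEnergy_le_log μ ht x).trans (mul_le_mul_of_nonneg_left ?_ (by positivity))
    calc _ ≤ p * (l + (M / (n * p) - 1)) := mul_le_mul_of_nonneg_left hlog hp.le
      _ = p * l + M / n - p := by field_simp; ring
      _ ≤ _ := by linarith
  refine (error_le_energy hn μ ht X x).trans ?_
  have h1 : p * l ≤ 2 * (M * l / n) * l := mul_le_mul_of_nonneg_right h.le (by linarith)
  have h2 : M / n ≤ M / n * (4 * l ^ 2) := le_mul_of_one_le_right (by positivity) (by nlinarith)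
  calc _ ≤ 2 * (4 * l / t * p + 2 / t * (p * l + M / n)) := by linarith
    _ = 4 / t * (3 * (p * l) + M / n) := by ring
    _ ≤ 4 / t * (3 * (2 * (M * l / n) * l) + M / n * (4 * l ^ 2)) := by gcongr
    _ = 40 * (M * l ^ 2 / (n * t)) := by field_simp; ring
    _ ≤ 256 * (M * l ^ 2 / (n * t)) := by gcongr; norm_num
    _ = _ := by ring

/-- The error where the density is above twice the threshold. -/
lemma error_le_of_threshold_le (h : 2 * threshold d n t ≤ smoothed μ t x) :
    ‖scoreEstimator X t x - (smoothed μ t x)⁻¹ • smoothedGradient μ t x‖ ^ 2 * smoothed μ t x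
      ≤ 16 / smoothed μ t x * (‖kdeGradient X t x - smoothedGradient μ t x‖ ^ 2
        + 4 * Real.log n / t * (kde X t x - smoothed μ t x) ^ 2) := by
  have hρ := threshold_pos d hn ht
  refine quotient_error_le (g := kdeGradient X t x) (q := kde X t x) (smoothed_pos μ ht x) (sq_norm_scoreEstimator_le hn X ht x)
    (sq_norm_score_le_of_threshold_le hn μ ht x (by linarith)) fun hq => ?_
  -- Twice the threshold in the hypothesis ensures that `q ≥ p/2` puts the estimator above its
  -- cutoff.
  rw [scoreEstimator, if_pos (by linarith)]

end Deterministic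

/-! ### Variance bounds -/

lemma lintegral_sq_average_sub_le {Ω : Type*} [MeasurableSpace Ω] (μ : Measure Ω)
    [IsProbabilityMeasure μ] {n : ℕ} (hn : 2 ≤ n) {f : Ω → ℝ} (hf : Measurable f) {C : ℝ}
    (hC : ∀ y, ‖f y‖ ≤ C) :
    ∫⁻ X : Fin n → Ω, ENNReal.ofReal (((n : ℝ)⁻¹ * ∑ i, f (X i) - ∫ y, f y ∂μ) ^ 2)
        ∂(Measure.pi fun _ => μ)
      ≤ ENNReal.ofReal ((n : ℝ)⁻¹ * ∫ y, f y ^ 2 ∂μ) := by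
  have hn0 : (n : ℝ) ≠ 0 := by exact_mod_cast (by omega : n ≠ 0)
  have hLp : MemLp f 2 μ := MemLp.of_bound hf.aestronglyMeasurable C (.of_forall hC)
  set P := Measure.pi fun _ : Fin n => μ
  have hev : ∀ i, MemLp (fun X : Fin n → Ω => f (X i)) 2 P := fun i =>
    hLp.comp_measurePreserving (measurePreserving_eval (fun _ => μ) i)
  have hint : ∀ i, ∫ X, f (X i) ∂P = ∫ y, f y ∂μ := fun i =>
    integral_comp_eval (μ := fun _ => μ) hf.aestronglyMeasurable
  have hsum : MemLp (fun X : Fin n → Ω => (n : ℝ)⁻¹ * ∑ i, f (X i)) 2 P :=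
    (memLp_finsetSum _ fun i _ => hev i).const_mul _
  have hmean : ∫ X, (n : ℝ)⁻¹ * ∑ i, f (X i) ∂P = ∫ y, f y ∂μ := by
    rw [integral_const_mul, integral_finsetSum _ fun i _ => (hev i).integrable one_le_two]
    simp [hint, hn0]
  have hvar : ProbabilityTheory.variance (fun X : Fin n → Ω => (n : ℝ)⁻¹ * ∑ i, f (X i)) P
      = (n : ℝ)⁻¹ * ProbabilityTheory.variance f μ := by
    have h := ProbabilityTheory.variance_sum_pi (μ := fun _ : Fin n => μ) (X := fun _ => f)
      fun _ => hLp
    have h' : (∑ i : Fin n, fun X : Fin n → Ω => f (X i)) = fun X => ∑ i, f (X i) := by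
      ext X; simp
    rw [h'] at h
    rw [ProbabilityTheory.variance_const_mul, h]
    simp; field_simp
  have h := hsum.ofReal_variance_eq
  rw [ProbabilityTheory.evariance_eq_lintegral_ofReal, hmean] at h
  rw [← h, hvar]
  gcongr
  exact ProbabilityTheory.variance_le_expectation_sq hf.aestronglyMeasurable

/-- Both sides are sums over coordinates of the scalar case. -/
lemma lintegral_sq_norm_average_sub_le {Ω : Type*} [MeasurableSpace Ω] (μ : Measure Ω)
    [IsProbabilityMeasure μ] {n d : ℕ} (hn : 2 ≤ n) {f : Ω → Space d} (hf : Measurable f) {C : ℝ}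
    (hC : ∀ y, ‖f y‖ ≤ C) :
    ∫⁻ X : Fin n → Ω, ENNReal.ofReal (‖(n : ℝ)⁻¹ • ∑ i, f (X i) - ∫ y, f y ∂μ‖ ^ 2)
        ∂(Measure.pi fun _ => μ)
      ≤ ENNReal.ofReal ((n : ℝ)⁻¹ * ∫ y, ‖f y‖ ^ 2 ∂μ) := by
  have hfi : Integrable f μ := Integrable.of_bound hf.aestronglyMeasurable C (.of_forall hC)
  obtain ⟨g, hg⟩ : ∃ g : Fin d → Ω → ℝ, ∀ j y, f y j = g j y := ⟨fun j y => f y j, fun _ _ => rfl⟩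
  have hgm : ∀ j, Measurable (g j) := fun j => by
    rw [← show (fun y => f y j) = g j from funext (hg j)]
    fun_prop
  have hgC : ∀ j y, ‖g j y‖ ≤ C := fun j y =>
    hg j y ▸ (PiLp.norm_apply_le (f y) j).trans (hC y)
  have hint : ∀ j, (∫ y, f y ∂μ) j = ∫ y, g j y ∂μ := fun j => by
    simp only [← hg]
    exact ((EuclideanSpace.proj (𝕜 := ℝ) j).integral_comp_comm hfi).symm
  have hsq : ∀ j, Integrable (fun y => g j y ^ 2) μ := fun j =>
    Integrable.of_bound ((hgm j).pow_const 2).aestronglyMeasurable (C ^ 2) (.of_forall fun y => by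
      rw [norm_pow]; exact pow_le_pow_left₀ (norm_nonneg _) (hgC j y) 2)
  have hL : ∀ X : Fin n → Ω, ENNReal.ofReal (‖(n : ℝ)⁻¹ • ∑ i, f (X i) - ∫ y, f y ∂μ‖ ^ 2)
      = ∑ j, ENNReal.ofReal (((n : ℝ)⁻¹ * ∑ i, g j (X i) - ∫ y, g j y ∂μ) ^ 2) := fun X => by
    rw [EuclideanSpace.real_norm_sq_eq, ENNReal.ofReal_sum_of_nonneg fun _ _ => sq_nonneg _]
    refine Finset.sum_congr rfl fun j _ => ?_
    simp only [PiLp.sub_apply, PiLp.smul_apply, smul_eq_mul, hint, WithLp.ofLp_sum,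
      Finset.sum_apply, hg]
  have hR : ENNReal.ofReal ((n : ℝ)⁻¹ * ∫ y, ‖f y‖ ^ 2 ∂μ)
      = ∑ j, ENNReal.ofReal ((n : ℝ)⁻¹ * ∫ y, g j y ^ 2 ∂μ) := by
    simp only [EuclideanSpace.real_norm_sq_eq, hg]
    rw [integral_finsetSum _ fun j _ => hsq j, Finset.mul_sum,
      ENNReal.ofReal_sum_of_nonneg fun j _ => mul_nonneg (by positivity)
        (integral_nonneg fun y => sq_nonneg _)]
  rw [hR, lintegral_congr hL, lintegral_finsetSum _ fun j _ => by have := hgm j; fun_prop]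
  exact Finset.sum_le_sum fun j _ => lintegral_sq_average_sub_le μ hn (hgm j) (hgC j)

section Variance

variable {d n : ℕ} (hn : 2 ≤ n) (μ : Measure (Space d)) [IsProbabilityMeasure μ] {t : ℝ}
  (ht : 0 < t) (x : Space d)

include hn ht

/-- The second moment of the kernel is bounded by `φ² ≤ M φ`. Keeping one factor `φ` leaves a `p`
that will cancel the `1/p` of the quotient bound. -/
lemma lintegral_kde_sub_le :
    ∫⁻ X : Fin n → Space d, ENNReal.ofReal ((kde X t x - smoothed μ t x) ^ 2)
        ∂(Measure.pi fun _ => μ)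
      ≤ ENNReal.ofReal (gaussianPeak d t * smoothed μ t x / n) := by
  have hb : ∀ y, ‖gaussianKernel t (x - y)‖ ≤ gaussianPeak d t := fun y => by
    rw [Real.norm_of_nonneg (gaussianKernel_pos ht _).le]; exact gaussianKernel_le_peak ht _
  refine (lintegral_sq_average_sub_le μ hn (f := fun y => gaussianKernel t (x - y))
    (by fun_prop) hb).trans (ENNReal.ofReal_le_ofReal ?_)
  rw [div_eq_inv_mul]
  refine mul_le_mul_of_nonneg_left ?_ (by positivity)
  rw [smoothed, ← integral_const_mul]
  refine integral_mono_of_nonneg (.of_forall fun y => sq_nonneg _)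
    ((integrable_gaussianKernel_sub μ ht x).const_mul _) (.of_forall fun y => ?_)
  simp only [sq]
  gcongr
  · exact (gaussianKernel_pos ht _).le
  · exact gaussianKernel_le_peak ht _

lemma lintegral_kdeGradient_sub_le :
    ∫⁻ X : Fin n → Space d,
        ENNReal.ofReal (‖kdeGradient X t x - smoothedGradient μ t x‖ ^ 2)
        ∂(Measure.pi fun _ => μ)
      ≤ ENNReal.ofReal (2 * gaussianPeak d t * smoothed μ t x / (n * t)) := by
  have h := lintegral_sq_norm_average_sub_le μ hn
    (f := fun y => gaussianKernel t (x - y) • (t⁻¹ • (y - x))) (by fun_prop)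
    (fun y => (norm_gaussianKernel_smul ht x y).trans_le (gaussianKernel_mul_norm_le ht x y))
  have h' : ∀ X : Fin n → Space d, kdeGradient X t x
      = (n : ℝ)⁻¹ • ∑ i, gaussianKernel t (x - X i) • (t⁻¹ • (X i - x)) := fun X => by
    rw [← smoothedGradient_empirical, smoothedGradient, integral_empirical X]
  simp only [h']
  refine h.trans (ENNReal.ofReal_le_ofReal ?_)
  have h2 : 2 * gaussianPeak d t * smoothed μ t x / (n * t)
      = (n : ℝ)⁻¹ * ∫ y, 2 * gaussianPeak d t / t * gaussianKernel t (x - y) ∂μ := by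
    rw [integral_const_mul, smoothed]; field_simp
  rw [h2]
  refine mul_le_mul_of_nonneg_left ?_ (by positivity)
  refine integral_mono_of_nonneg (.of_forall fun y => sq_nonneg _)
    ((integrable_gaussianKernel_sub μ ht x).const_mul _) (.of_forall fun y => ?_)
  simp only [norm_gaussianKernel_smul ht]
  have hk := gaussianKernel_pos ht (x - y)
  calc _ = gaussianKernel t (x - y) * (‖x - y‖ ^ 2 / t ^ 2) * gaussianKernel t (x - y) := by ring
    _ ≤ _ := by gcongr; exact gaussianKernel_mul_sq_le ht _

/-- The expected weighted error at a point. -/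
lemma lintegral_error_le :
    ∫⁻ X : Fin n → Space d, ENNReal.ofReal
        (‖scoreEstimator X t x - (smoothed μ t x)⁻¹ • smoothedGradient μ t x‖ ^ 2
          * smoothed μ t x) ∂(Measure.pi fun _ => μ)
      ≤ ENNReal.ofReal (256 * gaussianPeak d t * Real.log n ^ 2 / (n * t)) := by
  have hl := half_le_log hn
  have hM := gaussianPeak_pos d ht
  have hp := smoothed_pos μ ht x
  rcases lt_or_ge (smoothed μ t x) (2 * threshold d n t) with h | h
  · calc _ ≤ ∫⁻ _ : Fin n → Space d,
          ENNReal.ofReal (256 * gaussianPeak d t * Real.log n ^ 2 / (n * t))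
          ∂(Measure.pi fun _ => μ) := lintegral_mono fun X =>
            ENNReal.ofReal_le_ofReal (error_le_of_lt_threshold hn μ ht X x h)
      _ = _ := by simp
  · have h16 : 0 ≤ 16 / smoothed μ t x := by positivity
    have hB : 0 ≤ 4 * Real.log n / t := by positivity
    have hmeas : Measurable fun X : Fin n → Space d =>
        ENNReal.ofReal (‖kdeGradient X t x - smoothedGradient μ t x‖ ^ 2) := by
      unfold kdeGradient; fun_prop
    calc _ ≤ ∫⁻ X : Fin n → Space d, ENNReal.ofReal (16 / smoothed μ t x)
            * (ENNReal.ofReal (‖kdeGradient X t x - smoothedGradient μ t x‖ ^ 2)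
            + ENNReal.ofReal (4 * Real.log n / t)
              * ENNReal.ofReal ((kde X t x - smoothed μ t x) ^ 2)) ∂(Measure.pi fun _ => μ) := by
          refine lintegral_mono fun X => ?_
          rw [← ENNReal.ofReal_mul hB, ← ENNReal.ofReal_add (by positivity) (by positivity),
            ← ENNReal.ofReal_mul h16]
          exact ENNReal.ofReal_le_ofReal (error_le_of_threshold_le hn μ ht X x h)
      _ ≤ ENNReal.ofReal (16 / smoothed μ t x)
            * (ENNReal.ofReal (2 * gaussianPeak d t * smoothed μ t x / (n * t))
            + ENNReal.ofReal (4 * Real.log n / t)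
              * ENNReal.ofReal (gaussianPeak d t * smoothed μ t x / n)) := by
          rw [lintegral_const_mul' _ _ ENNReal.ofReal_ne_top, lintegral_add_left hmeas,
            lintegral_const_mul' _ _ ENNReal.ofReal_ne_top]
          gcongr
          · exact lintegral_kdeGradient_sub_le hn μ ht x
          · exact lintegral_kde_sub_le hn μ ht x
      _ ≤ _ := by
          rw [← ENNReal.ofReal_mul hB, ← ENNReal.ofReal_add (by positivity) (by positivity),
            ← ENNReal.ofReal_mul h16]
          refine ENNReal.ofReal_le_ofReal ?_
          have h3 : 0 ≤ gaussianPeak d t / (n * t) := by positivity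
          -- The density has cancelled; `log n ≥ 1/2` turns `2 + 4 log n` into a multiple of `(log
          -- n)²`.
          calc _ = 16 * (2 + 4 * Real.log n) * (gaussianPeak d t / (n * t)) := by field_simp
            _ ≤ 256 * Real.log n ^ 2 * (gaussianPeak d t / (n * t)) := by
                gcongr ?_ * _; nlinarith
            _ = _ := by ring

end Variance

/-! ### The law with a given density -/

lemma IsProbDensity.isProbabilityMeasure_lawOf {d : ℕ} {p : Space d → ℝ} (h : IsProbDensity p) :
    IsProbabilityMeasure (lawOf p) := by
  refine ⟨?_⟩
  rw [lawOf, withDensity_apply _ MeasurableSet.univ, Measure.restrict_univ,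
    ← ofReal_integral_eq_lintegral_ofReal h.integrable h.nonneg, h.integral_eq_one,
    ENNReal.ofReal_one]

lemma IsProbDensity.marginalDensity_eq {d : ℕ} {p : Space d → ℝ} (h : IsProbDensity p) (t : ℝ) :
    marginalDensity p t = smoothed (lawOf p) t := by
  ext x
  rw [marginalDensity, smoothed, lawOf, integral_withDensity_eq_integral_toReal_smul₀
    h.integrable.aestronglyMeasurable.aemeasurable.ennreal_ofReal
    (.of_forall fun _ => ENNReal.ofReal_lt_top)]
  refine integral_congr_ae (h.nonneg.mono fun y hy => ?_)
  simp only [ENNReal.toReal_ofReal hy, smul_eq_mul, mul_comm]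

lemma IsProbDensity.score_eq {d : ℕ} {p : Space d → ℝ} (h : IsProbDensity p) {t : ℝ} (ht : 0 < t)
    (x : Space d) :
    score p t x = (smoothed (lawOf p) t x)⁻¹ • smoothedGradient (lawOf p) t x := by
  have := h.isProbabilityMeasure_lawOf
  rw [score, h.marginalDensity_eq, gradient_log_smoothed _ ht]

lemma integrable_exp_neg_mul_norm_rpow {d : ℕ} (hd : 1 ≤ d) {γ c : ℝ} (hγ : 0 < γ) (hc : 0 < c) :
    Integrable fun x : Space d => Real.exp (-c * ‖x‖ ^ γ) := by
  have : Nonempty (Fin d) := ⟨⟨0, hd⟩⟩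
  have h := integrableOn_rpow_mul_exp_neg_mul_rpow (s := ((d - 1 : ℕ) : ℝ)) (p := γ) (b := c)
    (by have : (0 : ℝ) ≤ ((d - 1 : ℕ) : ℝ) := Nat.cast_nonneg _
        linarith) hγ hc
  rw [integrable_fun_norm_addHaar (volume : Measure (Space d))
    (f := fun r => Real.exp (-c * r ^ γ)), finrank_euclideanSpace_fin]
  simpa only [Real.rpow_natCast, smul_eq_mul] using h

/-- One half of the exponent gives the decay in `R`, the other half remains integrable. -/
lemma lawOf_compl_closedBall_le {d : ℕ} (hd : 1 ≤ d) {γ c₁ C₁ : ℝ} (hγ : 0 < γ) (hc₁ : 0 < c₁)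
    (hC₁ : 0 < C₁) {p : Space d → ℝ} (hp : ExpTail γ c₁ C₁ p) {R : ℝ} (hR : 0 ≤ R) :
    lawOf p (Metric.closedBall 0 R)ᶜ ≤ ENNReal.ofReal
      (C₁ * (∫ x : Space d, Real.exp (-(c₁ / 2) * ‖x‖ ^ γ)) * Real.exp (-(c₁ / 2 * R ^ γ))) := by
  have hI := integrable_exp_neg_mul_norm_rpow hd hγ (half_pos hc₁)
  have hS : MeasurableSet (Metric.closedBall (0 : Space d) R)ᶜ :=
    Metric.isClosed_closedBall.measurableSet.compl
  rw [lawOf, withDensity_apply _ hS]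
  calc _ ≤ ∫⁻ x in (Metric.closedBall (0 : Space d) R)ᶜ,
        ENNReal.ofReal (C₁ * Real.exp (-(c₁ / 2 * R ^ γ)) * Real.exp (-(c₁ / 2) * ‖x‖ ^ γ)) := by
        refine setLIntegral_mono_ae' hS (hp.mono fun x hx hxS => ENNReal.ofReal_le_ofReal ?_)
        refine hx.trans ?_
        rw [mul_assoc, ← Real.exp_add]
        have hxR : R ≤ ‖x‖ := by
          simp only [Set.mem_compl_iff, mem_closedBall_zero_iff, not_le] at hxS
          exact hxS.le
        have := Real.rpow_le_rpow hR hxR hγ.le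
        gcongr
        nlinarith
    _ ≤ ∫⁻ x : Space d,
        ENNReal.ofReal (C₁ * Real.exp (-(c₁ / 2 * R ^ γ)) * Real.exp (-(c₁ / 2) * ‖x‖ ^ γ)) :=
        setLIntegral_le_lintegral _ _
    _ = _ := by
        rw [← ofReal_integral_eq_lintegral_ofReal (hI.const_mul _)
          (.of_forall fun x => by positivity), integral_const_mul]
        congr 1; ring

/-! ### Tails of the smoothed measure -/

lemma setLIntegral_gaussianKernel_le {d : ℕ} {t : ℝ} (ht : 0 < t) {R₀ R₁ : ℝ} (hR₁ : 0 ≤ R₁)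
    {y : Space d} (hy : ‖y‖ ≤ R₀) :
    ∫⁻ x in (Metric.closedBall (0 : Space d) (R₀ + R₁))ᶜ,
        ENNReal.ofReal (gaussianKernel t (x - y))
      ≤ ENNReal.ofReal (2 ^ ((d : ℝ) / 2) * Real.exp (-(R₁ ^ 2 / (4 * t)))) := by
  have ht2 : 0 < 2 * t := by positivity
  calc _ ≤ ∫⁻ x in (Metric.closedBall (0 : Space d) (R₀ + R₁))ᶜ,
        ENNReal.ofReal (2 ^ ((d : ℝ) / 2) * Real.exp (-(R₁ ^ 2 / (4 * t))))
          * ENNReal.ofReal (gaussianKernel (2 * t) (x - y)) := by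
        refine setLIntegral_mono' Metric.isClosed_closedBall.measurableSet.compl fun x hx => ?_
        rw [← ENNReal.ofReal_mul (by positivity), gaussianKernel_eq_two_mul ht]
        refine ENNReal.ofReal_le_ofReal ?_
        have hk := gaussianKernel_pos ht2 (x - y)
        have hx' : R₁ ≤ ‖x - y‖ := by
          simp only [Set.mem_compl_iff, mem_closedBall_zero_iff, not_le] at hx
          linarith [norm_le_norm_add_norm_sub' x y]
        calc _ ≤ 2 ^ ((d : ℝ) / 2) * gaussianKernel (2 * t) (x - y)
              * Real.exp (-(R₁ ^ 2 / (4 * t))) := by gcongr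
          _ = _ := by ring
    _ ≤ ∫⁻ x : Space d, ENNReal.ofReal (2 ^ ((d : ℝ) / 2) * Real.exp (-(R₁ ^ 2 / (4 * t))))
          * ENNReal.ofReal (gaussianKernel (2 * t) (x - y)) := setLIntegral_le_lintegral _ _
    _ = _ := by
        rw [lintegral_const_mul' _ _ ENNReal.ofReal_ne_top,
          lintegral_sub_right_eq_self (fun z => ENNReal.ofReal (gaussianKernel (2 * t) z)) y,
          lintegral_gaussianKernel ht2, mul_one]

/-- If `Y + √t Z` lies outside the ball of radius `R₀ + R₁`, then `‖Y‖ > R₀` or `√t ‖Z‖ > R₁`. -/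
lemma setLIntegral_smoothed_le {d : ℕ} (μ : Measure (Space d)) [IsProbabilityMeasure μ] {t : ℝ}
    (ht : 0 < t) {R₀ R₁ : ℝ} (hR₁ : 0 ≤ R₁) :
    ∫⁻ x in (Metric.closedBall (0 : Space d) (R₀ + R₁))ᶜ, ENNReal.ofReal (smoothed μ t x)
      ≤ μ (Metric.closedBall 0 R₀)ᶜ
        + ENNReal.ofReal (2 ^ ((d : ℝ) / 2) * Real.exp (-(R₁ ^ 2 / (4 * t)))) := by
  have hS : MeasurableSet (Metric.closedBall (0 : Space d) R₀)ᶜ :=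
    Metric.isClosed_closedBall.measurableSet.compl
  calc _ = ∫⁻ x in (Metric.closedBall (0 : Space d) (R₀ + R₁))ᶜ, ∫⁻ y,
        ENNReal.ofReal (gaussianKernel t (x - y)) ∂μ := by
        refine lintegral_congr fun x => ?_
        rw [smoothed, ofReal_integral_eq_lintegral_ofReal (integrable_gaussianKernel_sub μ ht x)
          (.of_forall fun y => (gaussianKernel_pos ht _).le)]
    _ = ∫⁻ y, (∫⁻ x in (Metric.closedBall (0 : Space d) (R₀ + R₁))ᶜ,
        ENNReal.ofReal (gaussianKernel t (x - y))) ∂μ := by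
        refine lintegral_lintegral_swap ?_
        unfold Function.uncurry
        fun_prop
    _ ≤ ∫⁻ y, ((Metric.closedBall (0 : Space d) R₀)ᶜ.indicator 1 y
        + ENNReal.ofReal (2 ^ ((d : ℝ) / 2) * Real.exp (-(R₁ ^ 2 / (4 * t))))) ∂μ := by
        refine lintegral_mono fun y => ?_
        by_cases hy : ‖y‖ ≤ R₀
        · exact (setLIntegral_gaussianKernel_le ht hR₁ hy).trans le_add_self
        · refine le_add_right ?_
          rw [Set.indicator_of_mem (by simpa using hy)]
          refine (setLIntegral_le_lintegral _ _).trans_eq ?_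
          rw [lintegral_sub_right_eq_self (fun z => ENNReal.ofReal (gaussianKernel t z)) y,
            lintegral_gaussianKernel ht, Pi.one_apply]
    _ = _ := by
        rw [lintegral_add_right _ measurable_const, lintegral_indicator_one hS, lintegral_const,
          measure_univ, mul_one]

/-! ### The score error at a fixed time -/

lemma continuous_smoothed {d : ℕ} (μ : Measure (Space d)) [IsProbabilityMeasure μ] {t : ℝ}
    (ht : 0 < t) : Continuous (smoothed μ t) :=
  continuous_iff_continuousAt.2 fun x => (hasGradientAt_smoothed μ ht x).continuousAt

lemma measurable_smoothedGradient {d : ℕ} (μ : Measure (Space d)) [IsProbabilityMeasure μ] (t : ℝ) :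
    Measurable (smoothedGradient μ t) := by
  have h : Continuous fun q : Space d × Space d =>
      gaussianKernel t (q.1 - q.2) • (t⁻¹ • (q.2 - q.1)) := by fun_prop
  exact h.stronglyMeasurable.integral_prod_right.measurable

lemma measurable_scoreEstimator {d n : ℕ} (t : ℝ) :
    Measurable fun q : (Fin n → Space d) × Space d => scoreEstimator q.1 t q.2 := by
  have h1 : Continuous fun q : (Fin n → Space d) × Space d => kde q.1 t q.2 := by
    unfold kde; fun_prop
  have h2 : Continuous fun q : (Fin n → Space d) × Space d => kdeGradient q.1 t q.2 := by
    unfold kdeGradient; fun_prop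
  unfold scoreEstimator
  exact Measurable.ite (measurableSet_le measurable_const h1.measurable)
    (h1.measurable.inv.smul h2.measurable) measurable_const

/-- After Tonelli, the uniform bound is used inside the ball and the crude one outside. The crude
bound smooths at time `2t`, hence `8t` in the Gaussian tail. -/
lemma scoreError_le {d n : ℕ} (hn : 2 ≤ n) {p : Space d → ℝ} (hp : IsProbDensity p) {t : ℝ}
    (ht : 0 < t) {R₀ R₁ : ℝ} (hR₁ : 0 ≤ R₁) :
    scoreError p n t
      ≤ ENNReal.ofReal (256 * gaussianPeak d t * Real.log n ^ 2 / (n * t))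
          * volume (Metric.closedBall (0 : Space d) (R₀ + R₁))
        + ENNReal.ofReal (24 * Real.log n / t * 2 ^ ((d : ℝ) / 2))
          * (lawOf p (Metric.closedBall 0 R₀)ᶜ
            + ENNReal.ofReal (2 ^ ((d : ℝ) / 2) * Real.exp (-(R₁ ^ 2 / (8 * t))))) := by
  have hl := half_le_log hn
  have := hp.isProbabilityMeasure_lawOf
  set μ := lawOf p with hμ
  have hB : MeasurableSet (Metric.closedBall (0 : Space d) (R₀ + R₁)) :=
    Metric.isClosed_closedBall.measurableSet
  have hswap : scoreError p n t = ∫⁻ x, ∫⁻ X : Fin n → Space d, ENNReal.ofReal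
        (‖scoreEstimator X t x - (smoothed μ t x)⁻¹ • smoothedGradient μ t x‖ ^ 2
          * smoothed μ t x) ∂(Measure.pi fun _ => μ) := by
    simp only [scoreError, hp.score_eq ht, hp.marginalDensity_eq]
    refine lintegral_lintegral_swap (Measurable.aemeasurable ?_)
    have h1 := measurable_scoreEstimator (d := d) (n := n) t
    have h2 := (continuous_smoothed μ ht).measurable
    have h3 := measurable_smoothedGradient μ t
    unfold Function.uncurry
    exact (((h1.sub ((h2.comp measurable_snd).inv.smul (h3.comp measurable_snd))).norm.pow_const 2
      |>.mul (h2.comp measurable_snd))).ennreal_ofReal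
  rw [hswap, ← lintegral_add_compl _ hB]
  gcongr ?_ + ?_
  · calc _ ≤ ∫⁻ _ in Metric.closedBall (0 : Space d) (R₀ + R₁),
          ENNReal.ofReal (256 * gaussianPeak d t * Real.log n ^ 2 / (n * t)) :=
          lintegral_mono fun x => lintegral_error_le hn μ ht x
      _ = _ := setLIntegral_const _ _
  · calc _ ≤ ∫⁻ x in (Metric.closedBall (0 : Space d) (R₀ + R₁))ᶜ,
            ENNReal.ofReal (24 * Real.log n / t * 2 ^ ((d : ℝ) / 2))
              * ENNReal.ofReal (smoothed μ (2 * t) x) := by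
          refine lintegral_mono fun x => ?_
          rw [← ENNReal.ofReal_mul (by positivity), mul_assoc]
          calc _ ≤ ∫⁻ _ : Fin n → Space d, ENNReal.ofReal (24 * Real.log n / t
                  * (2 ^ ((d : ℝ) / 2) * smoothed μ (2 * t) x)) ∂(Measure.pi fun _ => μ) :=
                lintegral_mono fun X =>
                  ENNReal.ofReal_le_ofReal (error_le_smoothed_two_mul hn μ ht X x)
            _ = _ := by simp
      _ ≤ _ := by
          rw [lintegral_const_mul' _ _ ENNReal.ofReal_ne_top]
          gcongr
          have h := setLIntegral_smoothed_le μ (by positivity : 0 < 2 * t) (R₀ := R₀) hR₁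
          rwa [show 4 * (2 * t) = 8 * t by ring] at h

lemma gaussianPeak_le (d : ℕ) {t : ℝ} (ht : 0 < t) : gaussianPeak d t ≤ t ^ (-((d : ℝ) / 2)) := by
  rw [gaussianPeak, Real.rpow_neg ht.le]
  gcongr
  nlinarith [Real.pi_gt_three]

/-- The score error at time `t` is at most of order `(log n)^k n⁻¹ t⁻¹ (1 + t^{-d/2})`. -/
lemma exists_scoreError_le {d : ℕ} (hd : 1 ≤ d) {γ c₁ C₁ : ℝ} (hγ : 0 < γ) (hc₁ : 0 < c₁)
    (hC₁ : 0 < C₁) :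
    ∃ k : ℕ, ∃ K : ℝ, 0 < K ∧ ∀ p : Space d → ℝ, ExpTail γ c₁ C₁ p → IsProbDensity p →
      ∀ n : ℕ, 2 ≤ n → ∀ t : ℝ, 0 < t → scoreError p n t
        ≤ ENNReal.ofReal (K * Real.log n ^ k * (n : ℝ)⁻¹ * (t⁻¹ * (1 + t ^ (-((d : ℝ) / 2))))) := by
  -- A natural `m` with `mγ ≥ 1` makes `(2 log n)^m` a sufficient radius for the stretched
  -- exponential tail; `m ≥ 1` serves the Gaussian tail.
  obtain ⟨m, hm⟩ := exists_nat_ge (max 1 (1 / γ))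
  have hm1 : 1 ≤ m := by exact_mod_cast (le_max_left _ _).trans hm
  have hmγ : 1 ≤ m * γ := (div_le_iff₀ hγ).1 ((le_max_right _ _).trans hm)
  set a : ℝ := c₁⁻¹ ^ γ⁻¹ with ha
  have ha0 : 0 < a := by positivity
  set V : ℝ := (volume (Metric.ball (0 : Space d) 1)).toReal with hV
  have hV0 : 0 ≤ V := ENNReal.toReal_nonneg
  set I : ℝ := ∫ x : Space d, Real.exp (-(c₁ / 2) * ‖x‖ ^ γ) with hI
  have hI0 : 0 ≤ I := integral_nonneg fun x => (Real.exp_pos _).le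
  set D : ℝ := 2 ^ ((d : ℝ) / 2) with hD
  have hD0 : 0 < D := by positivity
  set K₁ : ℝ := 256 * 2 ^ (d - 1) * (a ^ d + 2 ^ d) * V with hK₁
  have hK₁0 : 0 ≤ K₁ := by positivity
  set K₂ : ℝ := 24 * D * (C₁ * I + D) with hK₂
  have hK₂0 : 0 < K₂ := by positivity
  -- The volume of the ball contributes `m d` logarithms and the pointwise error two. The power of 2
  -- pays for working with `2 log n ≥ 1`, whose powers increase with the exponent.
  refine ⟨m * d + 2, (K₁ + K₂) * 2 ^ (m * d + 2), by positivity, ?_⟩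
  intro p hp hpd n hn t ht
  have hl := half_le_log hn
  have hn0 : (0 : ℝ) < n := by exact_mod_cast (by omega : 0 < n)
  set s : ℝ := t ^ (-((d : ℝ) / 2)) with hs
  have hs0 : 0 < s := by positivity
  set l := Real.log n with hldef
  have hl1 : 1 ≤ 2 * l := by linarith
  have hexp : Real.exp (-l) = (n : ℝ)⁻¹ := by rw [Real.exp_neg, hldef, Real.exp_log hn0]
  -- The radii make both tails at most of order `n⁻¹`. The factor `√t` in `R₁` matches the width of
  -- the Gaussian, so that its `d`-th power cancels `t^{-d/2}`.
  set R₀ : ℝ := a * (2 * l) ^ m with hR₀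
  set R₁ : ℝ := 2 * √t * (2 * l) ^ m with hR₁
  have hR₀0 : 0 ≤ R₀ := by positivity
  have hR₁0 : 0 ≤ R₁ := by positivity
  have hpow : ∀ k : ℕ, (1 : ℝ) ≤ (2 * l) ^ k := fun k => one_le_pow₀ hl1
  -- the tail of the initial law
  have htail : lawOf p (Metric.closedBall 0 R₀)ᶜ ≤ ENNReal.ofReal (C₁ * I * (n : ℝ)⁻¹) := by
    refine (lawOf_compl_closedBall_le hd hγ hc₁ hC₁ hp hR₀0).trans (ENNReal.ofReal_le_ofReal ?_)
    rw [← hexp]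
    have h1 : R₀ ^ γ = c₁⁻¹ * (2 * l) ^ (m * γ) := by
      rw [hR₀, Real.mul_rpow ha0.le (by positivity), ha, ← Real.rpow_mul (by positivity),
        inv_mul_cancel₀ hγ.ne', Real.rpow_one, ← Real.rpow_natCast, ← Real.rpow_mul (by positivity)]
    have h2 : 2 * l ≤ (2 * l) ^ (m * γ) := by
      simpa using Real.rpow_le_rpow_of_exponent_le hl1 hmγ
    have h3 : c₁ / 2 * R₀ ^ γ = (2 * l) ^ (m * γ) / 2 := by rw [h1]; field_simp
    gcongr
    rw [h3]; linarith
  -- the Gaussian tail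
  have hgauss : D * Real.exp (-(R₁ ^ 2 / (8 * t))) ≤ D * (n : ℝ)⁻¹ := by
    rw [← hexp]
    have h1 : R₁ ^ 2 / (8 * t) = ((2 * l) ^ m) ^ 2 / 2 := by
      rw [hR₁, mul_pow, mul_pow, Real.sq_sqrt ht.le]; field_simp; norm_num
    have h2 : 2 * l ≤ (2 * l) ^ m := le_self_pow₀ hl1 (by omega)
    have h3 : (2 * l) ^ m ≤ ((2 * l) ^ m) ^ 2 := le_self_pow₀ (hpow m) two_ne_zero
    gcongr
    rw [h1]; linarith
  -- the volume of the ball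
  have hvol : volume (Metric.closedBall (0 : Space d) (R₀ + R₁))
      = ENNReal.ofReal ((R₀ + R₁) ^ d * V) := by
    rw [Measure.addHaar_closedBall _ _ (by positivity), finrank_euclideanSpace_fin,
      ENNReal.ofReal_mul (by positivity), hV, ENNReal.ofReal_toReal measure_ball_lt_top.ne]
  have hRd : gaussianPeak d t * (R₀ + R₁) ^ d
      ≤ 2 ^ (d - 1) * (a ^ d + 2 ^ d) * (2 * l) ^ (m * d) * (1 + s) := by
    have h1 : (R₀ + R₁) ^ d = (a + 2 * √t) ^ d * (2 * l) ^ (m * d) := by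
      rw [hR₀, hR₁, ← add_mul, mul_pow, pow_mul]
    have h2 : (a + 2 * √t) ^ d ≤ 2 ^ (d - 1) * (a ^ d + (2 * √t) ^ d) :=
      add_pow_le ha0.le (by positivity) d
    have h3 : s * √t ^ d = 1 := by
      rw [hs, Real.sqrt_eq_rpow, ← Real.rpow_natCast, ← Real.rpow_mul ht.le, ← Real.rpow_add ht]
      have : -((d : ℝ) / 2) + 1 / 2 * d = 0 := by ring
      rw [this, Real.rpow_zero]
    calc _ ≤ s * (2 ^ (d - 1) * (a ^ d + (2 * √t) ^ d) * (2 * l) ^ (m * d)) := by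
          rw [h1]; gcongr; exact gaussianPeak_le d ht
      _ = 2 ^ (d - 1) * (a ^ d * s + 2 ^ d * (s * √t ^ d)) * (2 * l) ^ (m * d) := by
          rw [mul_pow]; ring
      _ ≤ 2 ^ (d - 1) * ((a ^ d + 2 ^ d) * (1 + s)) * (2 * l) ^ (m * d) := by
          rw [h3]; gcongr
          have : 0 < a ^ d := by positivity
          have : (0 : ℝ) < 2 ^ d := by positivity
          nlinarith
      _ = _ := by ring
  refine (scoreError_le hn hpd ht hR₁0 (R₀ := R₀)).trans ?_
  rw [hvol, ← ENNReal.ofReal_mul (by have := gaussianPeak_pos d ht; positivity)]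
  calc _ ≤ ENNReal.ofReal (K₁ * (2 * l) ^ (m * d + 2) * (n : ℝ)⁻¹ * (t⁻¹ * (1 + s)))
        + ENNReal.ofReal (K₂ * (2 * l) ^ (m * d + 2) * (n : ℝ)⁻¹ * (t⁻¹ * (1 + s))) := by
        refine add_le_add (ENNReal.ofReal_le_ofReal ?_) ?_
        · calc _ = 256 * V * l ^ 2 / (n * t) * (gaussianPeak d t * (R₀ + R₁) ^ d) := by ring
            _ ≤ 256 * V * (2 * l) ^ 2 / (n * t)
                * (2 ^ (d - 1) * (a ^ d + 2 ^ d) * (2 * l) ^ (m * d) * (1 + s)) := by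
                have := gaussianPeak_pos d ht
                gcongr
                linarith
            _ = _ := by rw [hK₁, pow_add (2 * l)]; field_simp
        · calc _ ≤ ENNReal.ofReal (24 * l / t * D)
                * (ENNReal.ofReal (C₁ * I * (n : ℝ)⁻¹) + ENNReal.ofReal (D * (n : ℝ)⁻¹)) := by
                gcongr
            _ ≤ _ := by
                rw [← ENNReal.ofReal_add (by positivity) (by positivity),
                  ← ENNReal.ofReal_mul (by positivity)]
                refine ENNReal.ofReal_le_ofReal ?_
                calc _ = K₂ * l * (n : ℝ)⁻¹ * (t⁻¹ * 1) := by rw [hK₂]; ring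
                  _ ≤ _ := by
                    have h1 : l ≤ (2 * l) ^ (m * d + 2) :=
                      (by linarith : l ≤ 2 * l).trans (le_self_pow₀ hl1 (by omega))
                    gcongr
                    linarith
    _ = _ := by
        rw [← ENNReal.ofReal_add (by positivity) (by positivity)]
        congr 1
        rw [mul_pow]; ring

/-! ### Integration in time -/

lemma setLIntegral_time_le {a A t₀ T : ℝ} (ha : 0 < a) (hA : 0 ≤ A) (ht₀ : 0 < t₀)
    (hT : t₀ < T) :
    ∫⁻ t in Set.Icc t₀ T, ENNReal.ofReal (A * (t⁻¹ * (1 + t ^ (-a))))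
      ≤ ENNReal.ofReal (A * (Real.log (T / t₀) + t₀ ^ (-a) / a)) := by
  have hT0 : 0 < T := ht₀.trans hT
  have hpos : ∀ t ∈ Set.Ioc t₀ T, 0 < t := fun t ht => ht₀.trans ht.1
  have h0 : (0 : ℝ) ∉ Set.uIcc t₀ T := by
    rw [Set.uIcc_of_le hT.le]; exact fun h => absurd h.1 (not_le.2 ht₀)
  have hi1 : IntervalIntegrable (fun t : ℝ => t⁻¹) volume t₀ T :=
    intervalIntegral.intervalIntegrable_inv (fun x hx => ne_of_mem_of_not_mem hx h0)
      continuousOn_id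
  have hi2 : IntervalIntegrable (fun t : ℝ => t ^ (-a - 1)) volume t₀ T :=
    intervalIntegral.intervalIntegrable_rpow (Or.inr h0)
  have hi : IntervalIntegrable (fun t : ℝ => A * (t⁻¹ + t ^ (-a - 1))) volume t₀ T :=
    (hi1.add hi2).const_mul A
  have hE : ∀ t ∈ Set.Ioc t₀ T, A * (t⁻¹ * (1 + t ^ (-a))) = A * (t⁻¹ + t ^ (-a - 1)) := by
    intro t ht
    rw [Real.rpow_sub_one (hpos t ht).ne']; ring
  rw [← setLIntegral_congr Ioc_ae_eq_Icc,
    setLIntegral_congr_fun measurableSet_Ioc fun t ht => congrArg ENNReal.ofReal (hE t ht),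
    ← ofReal_integral_eq_lintegral_ofReal hi.1
      ((ae_restrict_iff' measurableSet_Ioc).2 (.of_forall fun t ht => by
        have := hpos t ht
        positivity)),
    ← intervalIntegral.integral_of_le hT.le, intervalIntegral.integral_const_mul,
    intervalIntegral.integral_add hi1 hi2, integral_inv_of_pos ht₀ hT0,
    integral_rpow (Or.inr ⟨by linarith, h0⟩)]
  refine ENNReal.ofReal_le_ofReal (mul_le_mul_of_nonneg_left ?_ hA)
  -- The primitive at the upper endpoint enters with a negative sign and is dropped.
  have hT' : 0 < T ^ (-a) := by positivity
  have : (T ^ (-a - 1 + 1) - t₀ ^ (-a - 1 + 1)) / (-a - 1 + 1)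
      = t₀ ^ (-a) / a - T ^ (-a) / a := by
    rw [sub_add_cancel]; field_simp; ring
  rw [this]
  have : 0 < T ^ (-a) / a := by positivity
  linarith

end HeavyTailScore

/-! ### The main theorem -/

open HeavyTailScore in
theorem theorem6 (d : ℕ) (hd : 1 ≤ d) (γ c₁ C₁ β L : ℝ) (hγ : 0 < γ) (hc₁ : 0 < c₁)
    (hC₁ : 0 < C₁) (hβ : 0 < β) (hL : 0 < L) :
    ∃ k : ℕ,
      (∀ T : ℝ, 0 < T → ∃ C : ℝ, 0 < C ∧
        ∀ p₀ : HeavyTailScore.Space d → ℝ,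
          HeavyTailScore.ExpTail γ c₁ C₁ p₀ → HeavyTailScore.SobolevClass β L p₀ →
          ∀ n : ℕ, 2 ≤ n → ∀ t₀ : ℝ, 0 < t₀ → t₀ < T →
            HeavyTailScore.integratedScoreError p₀ n t₀ T ≤
              ENNReal.ofReal
                (C * Real.log n ^ k * (n : ℝ)⁻¹ * t₀ ^ (-((d : ℝ) / 2)))) ∧
      (∃ C : ℝ, 0 < C ∧
        ∀ p₀ : HeavyTailScore.Space d → ℝ,
          HeavyTailScore.ExpTail γ c₁ C₁ p₀ → HeavyTailScore.SobolevClass β L p₀ →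
          ∀ n : ℕ, 2 ≤ n → ∀ T t₀ : ℝ, 0 < t₀ → t₀ < T → t₀ ≤ 1 →
            HeavyTailScore.integratedScoreError p₀ n t₀ T ≤
              ENNReal.ofReal
                (C * (1 + Real.posLog T) * Real.log n ^ k * (n : ℝ)⁻¹ *
                  t₀ ^ (-((d : ℝ) / 2)))) := by
  obtain ⟨k, K, hK, h⟩ := exists_scoreError_le hd hγ hc₁ hC₁
  have hd1 : (1 : ℝ) ≤ d := by exact_mod_cast hd
  have ha : 0 < (d : ℝ) / 2 := by positivity
  have hdiv : ∀ u : ℝ, 0 ≤ u → u / ((d : ℝ) / 2) ≤ 2 * u := fun u hu => by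
    rw [div_le_iff₀ ha]; nlinarith
  have hint : ∀ p₀ : Space d → ℝ, ExpTail γ c₁ C₁ p₀ → SobolevClass β L p₀ → ∀ n : ℕ, 2 ≤ n →
      ∀ t₀ T : ℝ, 0 < t₀ → t₀ < T → integratedScoreError p₀ n t₀ T
        ≤ ENNReal.ofReal (K * Real.log n ^ k * (n : ℝ)⁻¹
          * (Real.log (T / t₀) + 2 * t₀ ^ (-((d : ℝ) / 2)))) := by
    intro p₀ hp hS n hn t₀ T ht₀ hT
    have hl := half_le_log hn
    refine (setLIntegral_mono' measurableSet_Icc fun t ht =>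
      h p₀ hp hS.density n hn t (ht₀.trans_le ht.1)).trans
      ((setLIntegral_time_le ha (by positivity) ht₀ hT).trans (ENNReal.ofReal_le_ofReal ?_))
    gcongr
    exact hdiv _ (by positivity)
  refine ⟨k, fun T hT => ⟨K * (2 * T ^ ((d : ℝ) / 2) + 2), by positivity, ?_⟩,
    4 * K, by positivity, ?_⟩
  · intro p₀ hp hS n hn t₀ ht₀ hT'
    have hl := half_le_log hn
    refine (hint p₀ hp hS n hn t₀ T ht₀ hT').trans (ENNReal.ofReal_le_ofReal ?_)
    -- By `log u ≤ u^a / a` with `a = d/2`, the logarithm is absorbed into `t₀^{-d/2}` at the price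
    -- of a power of `T`.
    have hlog : Real.log (T / t₀) ≤ 2 * (T ^ ((d : ℝ) / 2) * t₀ ^ (-((d : ℝ) / 2))) := by
      refine (Real.log_le_rpow_div (by positivity) ha).trans ((hdiv _ (by positivity)).trans_eq ?_)
      rw [Real.div_rpow hT.le ht₀.le, Real.rpow_neg ht₀.le, div_eq_mul_inv]
    calc _ ≤ K * Real.log n ^ k * (n : ℝ)⁻¹ * (2 * (T ^ ((d : ℝ) / 2) * t₀ ^ (-((d : ℝ) / 2)))
          + 2 * t₀ ^ (-((d : ℝ) / 2))) := by gcongr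
      _ = _ := by ring
  · intro p₀ hp hS n hn T t₀ ht₀ hT ht₁
    have hl := half_le_log hn
    refine (hint p₀ hp hS n hn t₀ T ht₀ hT).trans (ENNReal.ofReal_le_ofReal ?_)
    have hs : 1 ≤ t₀ ^ (-((d : ℝ) / 2)) :=
      Real.one_le_rpow_of_pos_of_le_one_of_nonpos ht₀ ht₁ (by linarith)
    have hP : 0 ≤ Real.posLog T := Real.posLog_nonneg
    -- Here only `-log t₀` is bounded by a power, so `T` stays inside a logarithm; `t₀ ≤ 1` gives
    -- `t₀^{-d/2} ≥ 1`, which lets this term be multiplied by that power.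
    have hlog : Real.log (T / t₀) ≤ Real.posLog T + 2 * t₀ ^ (-((d : ℝ) / 2)) := by
      rw [div_eq_mul_inv, Real.log_mul (ht₀.trans hT).ne' (inv_ne_zero ht₀.ne')]
      refine add_le_add (le_max_right _ _) ?_
      refine (Real.log_le_rpow_div (by positivity) ha).trans ((hdiv _ (by positivity)).trans_eq ?_)
      rw [Real.inv_rpow ht₀.le, Real.rpow_neg ht₀.le]
    calc _ ≤ K * Real.log n ^ k * (n : ℝ)⁻¹
          * (4 * ((1 + Real.posLog T) * t₀ ^ (-((d : ℝ) / 2)))) := by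
          gcongr
          nlinarith
      _ = _ := by ring
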